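/- **Model.** $k$ identical deterministic finite-state ants start in the nest $(0,0)$ of the grid $\mathbb Z^2$, which initially carries no pheromones. In one atomic step an ant senses whether its current cell carries a pheromone, decides (from its state and this bit) whether to emit a pheromone there and whether and in which of the four directions to move, and then emits, moves and updates its state. Pheromones are all alike and permanent. An asynchronous adversary schedules one ant at a time; up to $f<k$ ants, chosen by the adversary, may fail-stop, each at any time. A round ends as soon as every ant that has not failed has performed at least one step in it. The search terminates as soon as some ant that starts a step is in the cell of the treasure, which is at an unknown Manhattan distance $D$ from the nest. **Algorithm.** Let $\mathrm{go}(d)$ mean: step in direction $d$, and continue as long as a pheromone is sensed; let $\mathrm{emit}()$ emit a pheromone in the current cell if it has none (sensing and emitting take place in the same atomic step). Every ant repeats the following, where a step of the ant may combine the sensing, an emission and the next move. 1. *Ray extension.* $\mathrm{go}(\text{east}),\mathrm{emit}(),\mathrm{go}(\text{west})$; $\mathrm{go}(\text{south}),\mathrm{emit}(),\mathrm{go}(\text{north})$; $\mathrm{go}(\text{west}),\mathrm{emit}(),\mathrm{go}(\text{east})$; $\mathrm{go}(\text{north}),\mathrm{emit}()$. The last emission takes place in some cell $(0,l)$. 2.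 *Exploration of layer $l$.* From $(0,l)$, perform $\mathrm{explore}(\text{east},\text{south})$, $\mathrm{explore}(\text{south},\text{west})$, $\mathrm{explore}(\text{west},\text{north})$, $\mathrm{explore}(\text{north},\text{east})$, where $\mathrm{explore}(\text{zig},\text{zag})$ repeats pairs of a step zig and a step zag until, at the end of a pair, a pheromone of the eastern (respectively southern, western, northern) ray is sensed. If a pheromone is sensed after the very first pair of $\mathrm{explore}(\text{east},\text{south})$, that is in $(1,l-1)$, the ant steps west and back east: a pheromone in $(0,l-1)$ shows that the pheromone in $(1,l-1)$ is the completion mark of layer $l-1$, and the exploration in the directions east, south goes on; no pheromone there shows that $l=1$ and that the eastern ray is reached. The exploration ends in $(0,l)$. 3. *Completion mark.* Step east, $\mathrm{emit}()$ in $(1,l)$, step west, step south. 4. *Verification.* As long as a pheromone is sensed in the current cell $(0,m)$: step east; if $(1,m)$ carries no pheromone, then explore layer $m$ as in 2 (the first step east having been made) and, back in $(0,m)$, step east and $\mathrm{emit}()$ in $(1,m)$; in any case step west, step south. When no pheromone is sensed, the ant is back in the nest and continues with 1. **Theorem.** There is a universal constant $C$ such that for all integers $0\le f<k$, every position of the treasure,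 at distance $D$ from the nest, and every behaviour of the adversary in which at most $f$ of the $k$ ants fail-stop, the search terminates. If moreover $k\le D$, it terminates within at most $$C\left(D+\frac{D^2}{k-f}+Df\right)$$ rounds, and the ants have by then performed at most $C\,D$ pheromone emissions in total. -/

import Mathlib

/-! ### The model: pheromone-emitting finite-state ants on the grid `ℤ × ℤ` -/

namespace Ants

/-- The four directions of the grid. -/
inductive Dir
  | east | south | west | north
  deriving DecidableEq

namespace Dir

instance : Fintype Dir where
  elems := {east, south, west, north}
  complete := by intro d; cases d <;> simp

/-- The next direction in clockwise order. -/
def cw : Dir → Dir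
  | east => south
  | south => west
  | west => north
  | north => east

/-- The opposite direction. -/
def opp : Dir → Dir
  | east => west
  | south => north
  | west => east
  | north => south

/-- The unit vector of a direction. -/
def vec : Dir → ℤ × ℤ
  | east => (1, 0)
  | south => (0, -1)
  | west => (-1, 0)
  | north => (0, 1)

end Dir

/-- What an ant decides in one step: whether it emits a pheromone in its current cell, where it then
moves (`none`: it holds its position), and its new state. -/
structure Action (Q : Type) where
  emit : Bool
  move : Option Dir
  next : Q

/-- A deterministic finite-state ant. `act q b` is the decision in state `q`, where `b` tells whether
there is a pheromone in the current cell. -/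
structure AntFSM (Q : Type) [Finite Q] where
  init : Q
  act : Q → Bool → Action Q

/-- The global configuration of `k` ants: their states and positions, the set of cells that carry a
pheromone, and the number of emissions performed so far. -/
structure Config (k : ℕ) (Q : Type) where
  state : Fin k → Q
  pos : Fin k → ℤ × ℤ
  pheromones : Finset (ℤ × ℤ)
  emissions : ℕ

/-- All ants start in the nest `(0, 0)`, and there are no pheromones. -/
def initConfig {Q : Type} [Finite Q] (M : AntFSM Q) (k : ℕ) : Config k Q where
  state := fun _ => M.init
  pos := fun _ => (0, 0)
  pheromones := ∅
  emissions := 0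

/-- One atomic step of the ant `a`: sense, decide, emit, move, update the state. -/
def Config.step {Q : Type} [Finite Q] {k : ℕ} (M : AntFSM Q) (c : Config k Q) (a : Fin k) :
    Config k Q :=
  let act := M.act (c.state a) (decide (c.pos a ∈ c.pheromones))
  { state := Function.update c.state a act.next
    pos := Function.update c.pos a (c.pos a + (act.move.map Dir.vec).getD 0)
    pheromones := if act.emit then insert (c.pos a) c.pheromones else c.pheromones
    emissions := if act.emit then c.emissions + 1 else c.emissions }

/-- The behaviour of the asynchronous adversary for `k` ants of which at most `f` fail-stop.
`ant t` is the ant that performs the step number `t = 0, 1, 2, …`. The ant `a` fail-stops at time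
`failTime a` (`⊤`: never), that is, it performs no step with a number `t ≥ failTime a`. -/
structure Adversary (k f : ℕ) where
  ant : ℕ → Fin k
  failTime : Fin k → ℕ∞
  alive : ∀ t : ℕ, (t : ℕ∞) < failTime (ant t)
  card_fail_le : {a : Fin k | failTime a ≠ ⊤}.ncard ≤ f

/-- The configuration after the first `t` steps. -/
def run {Q : Type} [Finite Q] (M : AntFSM Q) {k f : ℕ} (A : Adversary k f) : ℕ → Config k Q
  | 0 => initConfig M k
  | t + 1 => (run M A t).step M (A.ant t)

open Classical in
/-- The number of rounds that are completed by the first `t` steps, together with the set of ants that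
have already performed a step in the current round. A round ends as soon as every ant that has not
failed has performed at least one step in it. -/
noncomputable def roundState {k f : ℕ} (A : Adversary k f) : ℕ → ℕ × Finset (Fin k)
  | 0 => (0, ∅)
  | t + 1 =>
    let moved := insert (A.ant t) (roundState A t).2
    if ∀ a, a ∈ moved ∨ A.failTime a ≤ ((t + 1 : ℕ) : ℕ∞) then ((roundState A t).1 + 1, ∅)
    else ((roundState A t).1, moved)

/-- The (one-based) number of the round to which the step number `t` belongs. -/
noncomputable def roundOf {k f : ℕ} (A : Adversary k f) (t : ℕ) : ℕ := (roundState A t).1 + 1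

/-- The ant that performs the step number `t` is in the cell `x` at the beginning of this step. -/
def VisitsAt {Q : Type} [Finite Q] (M : AntFSM Q) {k f : ℕ} (A : Adversary k f)
    (x : ℤ × ℤ) (t : ℕ) : Prop :=
  (run M A t).pos (A.ant t) = x

/-- The search for a treasure in the cell `x` terminates at the step number `t`. -/
def TerminatesAt {Q : Type} [Finite Q] (M : AntFSM Q) {k f : ℕ} (A : Adversary k f)
    (x : ℤ × ℤ) (t : ℕ) : Prop :=
  VisitsAt M A x t ∧ ∀ u < t, ¬ VisitsAt M A x u

/-- The Manhattan distance of a cell from the nest. -/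
def dist (x : ℤ × ℤ) : ℕ := x.1.natAbs + x.2.natAbs

/-! ### The asynchronous fault-tolerant algorithm

An ant repeats the following forever.

* Ray extension: `go(east), emit(), go(west)`, then `go(south), emit(), go(north)`, then
  `go(west), emit(), go(east)`, then `go(north), emit()`, where `go(d)` makes a step in the direction
  `d` and then goes on as long as it senses a pheromone. The last emission, in a cell `(0, l)`, opens
  the layer `l`.
* Exploration of the layer `l` from `(0, l)`: `explore(east, south)`, `explore(south, west)`,
  `explore(west, north)`, `explore(north, east)`, where `explore(zig, zag)` repeats pairs of a step
  `zig` and a step `zag` until the eastern (southern, western, northern) ray is reached.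
* Completion mark: step east to `(1, l)`, emit, step west, step south.
* Verification: as long as there is a pheromone in the current cell `(0, m)`, step east to `(1, m)`;
  if there is no mark, explore the layer `m` and mark it in the same way; in any case step back west
  to `(0, m)` and step south. The loop ends in the nest.

`explore(east, south)` on the layer `l` passes the cell `(1, l - 1)` after its first pair of steps. If
`l ≥ 2`, a pheromone in it is the mark of the layer `l - 1`; if `l = 1`, it belongs to the eastern ray.
An ant that senses a pheromone there steps west and back: `(0, l - 1)` carries a pheromone
of the northern ray if `l ≥ 2`, and is the pheromone-free nest if `l = 1`.
-/

/-- The states of an ant. -/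
inductive Phase
  /-- in the nest, before the first step -/
  | start
  /-- travelling away from the nest along the ray `d` -/
  | out (d : Dir)
  /-- travelling back to the nest along the ray `d`, after having extended it -/
  | back (d : Dir)
  /-- in `explore(east, south)`, after the first step (to the east) -/
  | firstZig
  /-- in `explore(east, south)`, after the first pair of steps -/
  | firstPair
  /-- a pheromone was sensed after the first pair, and the ant has stepped west -/
  | probe
  /-- back from `probe`: the pheromone was a completion mark -/
  | onMark
  /-- back from `probe`: the pheromone belongs to the eastern ray -/
  | onRay
  /-- in `explore(d, d.cw)`, after a step in the direction `d` -/
  | zig (d : Dir)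
  /-- in `explore(d, d.cw)`, after a pair of steps -/
  | pair (d : Dir)
  /-- in the cell `(1, l)`, about to mark the layer `l` as completed -/
  | mark
  /-- on the northern ray, done with the current layer -/
  | descend
  /-- at the head of the verification loop -/
  | verify
  /-- in the cell `(1, m)`, checking whether the layer `m` is marked -/
  | check
  deriving DecidableEq, Fintype

open Dir Phase in
/-- The transition function of the asynchronous fault-tolerant algorithm. A pheromone is emitted only
in a cell without one (sensing and emitting are parts of the same atomic step). -/
def asyncFTAct : Phase → Bool → Action Phase
  | start, _ => ⟨false, some east, out east⟩
  -- ray extension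
  | out d, true => ⟨false, some d, out d⟩
  | out north, false => ⟨true, some east, firstZig⟩
  | out d, false => ⟨true, some d.opp, back d⟩
  | back d, true => ⟨false, some d.opp, back d⟩
  | back d, false => ⟨false, some d.cw, out d.cw⟩
  -- exploration of a layer
  | firstZig, _ => ⟨false, some south, firstPair⟩
  | firstPair, false => ⟨false, some east, zig east⟩
  | firstPair, true => ⟨false, some west, probe⟩
  | probe, true => ⟨false, some east, onMark⟩
  | probe, false => ⟨false, some east, onRay⟩
  | onMark, _ => ⟨false, some east, zig east⟩
  | onRay, _ => ⟨false, some south, zig south⟩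
  | zig d, _ => ⟨false, some d.cw, pair d⟩
  | pair d, false => ⟨false, some d, zig d⟩
  | pair north, true => ⟨false, some east, mark⟩
  | pair d, true => ⟨false, some d.cw, zig d.cw⟩
  -- completion mark
  | mark, b => ⟨!b, some west, descend⟩
  | descend, _ => ⟨false, some south, verify⟩
  -- verification
  | verify, true => ⟨false, some east, check⟩
  | verify, false => ⟨false, some east, out east⟩
  | check, true => ⟨false, some west, descend⟩
  | check, false => ⟨false, some south, firstPair⟩

/-- The asynchronous fault-tolerant algorithm. -/
def asyncFT : AntFSM Phase where
  init := Phase.start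
  act := asyncFTAct

end Ants

namespace Ants

/-! Let `D = dist x` and suppose `x` has not been visited. No exploration of layer `D` can have been
completed, so the mark `(1, D)` is missing. An ant that opens a layer `≥ D` therefore never gets
back to the nest: its verification would have to pass layer `D`, find it unmarked and explore it. So
at most `k` openings reach layer `D` or beyond, and as each other ray leads the northern one by at
most one cell per ant, all rays have length at most `N = D + 2k` (`invariant`, `Invariant.len_le`).

A potential (`fuel`) shows that an ant starts an exploration within any `18N + 10` of its own steps,
and it never starts the same layer twice (`startsAt_unique`). As there are only `N` layers, `x` is
eventually visited.

For the time bound, divide the rounds into phases long enough for every live ant to start an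
exploration. Pair each never-failing ant with each phase. Either the ant opens a layer in this or
the next phase, which accounts for at most `2N` pairs; or it re-explores a layer whose opener had a
full phase to mark it and did not, hence failed. A failed ant leaves at most one layer unmarked, so
there are at most (never-failing) × (failing) pairs of the second kind (`card_phases_le`). Dividing
by the number of never-failing ants, at least `k - f`, bounds the number of phases. -/

open Dir Phase

/-! ### Local invariant of a single ant and of the pheromone trail -/

/-- The layer on which an ant in the given phase and cell is working. -/
def layer : Phase → ℤ × ℤ → ℤ
  | firstPair, p | probe, p | onMark, p | onRay, p => p.2 + 1
  | zig east, p => p.1 + p.2 - 1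
  | zig south, p => p.1 - p.2 - 1
  | zig west, p => -p.1 - p.2 - 1
  | zig north, p => p.2 - p.1 - 1
  | pair east, p => p.1 + p.2
  | pair south, p => p.1 - p.2
  | pair west, p => -p.1 - p.2
  | pair north, p => p.2 - p.1
  | _, p => p.2

/-- The phases of the exploration of a layer, up to its completion mark. -/
def Exploring : Phase → Prop
  | firstZig | firstPair | probe | onMark | onRay | zig _ | pair _ | mark => True
  | _ => False

/-- The cells in which an ant can be in a given phase, when the ray `d` has the length `ℓ d` and the
pheromones are in `P`. -/
def Located (ℓ : Dir → ℕ) (P : Finset (ℤ × ℤ)) : Phase → ℤ × ℤ → Prop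
  | start, p => p.1 = 0 ∧ p.2 = 0
  | out east, p => p.2 = 0 ∧ 1 ≤ p.1 ∧ p.1 ≤ ℓ east + 1
  | out south, p => p.1 = 0 ∧ 1 ≤ -p.2 ∧ -p.2 ≤ ℓ south + 1
  | out west, p => p.2 = 0 ∧ 1 ≤ -p.1 ∧ -p.1 ≤ ℓ west + 1
  | out north, p => p.1 = 0 ∧ 1 ≤ p.2 ∧ p.2 ≤ ℓ north + 1
  | back east, p => p.2 = 0 ∧ 0 ≤ p.1 ∧ p.1 ≤ ℓ east
  | back south, p => p.1 = 0 ∧ 0 ≤ -p.2 ∧ -p.2 ≤ ℓ south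
  | back west, p => p.2 = 0 ∧ 0 ≤ -p.1 ∧ -p.1 ≤ ℓ west
  | back north, _ => False
  | firstZig, p => p.1 = 1 ∧ 1 ≤ p.2 ∧ p.2 ≤ ℓ north
  | firstPair, p => p.1 = 1 ∧ 0 ≤ p.2 ∧ p.2 + 1 ≤ ℓ north
  | probe, p => p.1 = 0 ∧ 0 ≤ p.2 ∧ p.2 + 1 ≤ ℓ north
  | onMark, p => p.1 = 1 ∧ 1 ≤ p.2 ∧ p.2 + 1 ≤ ℓ north
  | onRay, p => p.1 = 1 ∧ p.2 = 0 ∧ 1 ≤ ℓ north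
  | zig east, p => 2 ≤ p.1 ∧ 1 ≤ p.2 ∧ p.1 + p.2 - 1 ≤ ℓ north
  | zig south, p => 1 ≤ p.1 ∧ p.2 ≤ -1 ∧ p.1 - p.2 - 1 ≤ ℓ north
  | zig west, p => p.1 ≤ -1 ∧ p.2 ≤ -1 ∧ -p.1 - p.2 - 1 ≤ ℓ north
  | zig north, p => p.1 ≤ -1 ∧ 1 ≤ p.2 ∧ p.2 - p.1 - 1 ≤ ℓ north
  | pair east, p => 2 ≤ p.1 ∧ 0 ≤ p.2 ∧ p.1 + p.2 ≤ ℓ north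
  | pair south, p => 0 ≤ p.1 ∧ p.2 ≤ -1 ∧ p.1 - p.2 ≤ ℓ north
  | pair west, p => p.1 ≤ -1 ∧ p.2 ≤ 0 ∧ -p.1 - p.2 ≤ ℓ north
  | pair north, p => p.1 ≤ 0 ∧ 1 ≤ p.2 ∧ p.2 - p.1 ≤ ℓ north
  | mark, p => p.1 = 1 ∧ 1 ≤ p.2 ∧ p.2 ≤ ℓ north
  | descend, p => p.1 = 0 ∧ 1 ≤ p.2 ∧ p.2 ≤ ℓ north ∧ (1, p.2) ∈ P
  | verify, p => p.1 = 0 ∧ 0 ≤ p.2 ∧ p.2 ≤ ℓ north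
  | check, p => p.1 = 1 ∧ 1 ≤ p.2 ∧ p.2 ≤ ℓ north

/-- The cell `x` of the layer that is being explored is still ahead of the ant. -/
def Ahead (x : ℤ × ℤ) : Phase → ℤ × ℤ → Prop
  | firstZig, p => ¬(0 ≤ x.1 ∧ p.2 ≤ x.2)
  | firstPair, p => ¬(0 ≤ x.1 ∧ p.2 + 1 ≤ x.2)
  | probe, p | onMark, p | onRay, p => ¬(0 ≤ x.1 ∧ p.2 ≤ x.2)
  | zig east, p => ¬(0 ≤ x.1 ∧ p.2 ≤ x.2)
  | pair east, p => ¬(0 ≤ x.1 ∧ p.2 + 1 ≤ x.2)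
  | zig south, p => 0 ≤ x.1 → x.2 < 0 ∧ x.1 < p.1
  | pair south, p => 0 ≤ x.1 → x.2 < 0 ∧ x.1 ≤ p.1
  | zig west, p => x.1 < 0 ∧ p.2 < x.2
  | pair west, p => x.1 < 0 ∧ p.2 ≤ x.2
  | zig north, p => x.1 < 0 ∧ 0 < x.2 ∧ p.1 < x.1
  | pair north, p => x.1 < 0 ∧ 0 < x.2 ∧ p.1 ≤ x.1
  | mark, _ | descend, _ => False
  | _, _ => True

/-- The pheromones `P` are those of rays of the lengths `ℓ d` and of completion marks, and neither
the ray cell nor the completion mark of the layer of the unvisited cell `x` betrays a visit to `x`. -/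
structure Trail (x : ℤ × ℤ) (ℓ : Dir → ℕ) (P : Finset (ℤ × ℤ)) : Prop where
  axis : ∀ a b : ℤ, a = 0 ∨ b = 0 → ((a, b) ∈ P ↔
    (b = 0 ∧ 1 ≤ a ∧ a ≤ ℓ east) ∨ (a = 0 ∧ 1 ≤ -b ∧ -b ≤ ℓ south) ∨
    (b = 0 ∧ 1 ≤ -a ∧ -a ≤ ℓ west) ∨ (a = 0 ∧ 1 ≤ b ∧ b ≤ ℓ north))
  offAxis : ∀ a b : ℤ, a ≠ 0 → b ≠ 0 → (a, b) ∈ P → a = 1 ∧ 1 ≤ b ∧ b ≤ ℓ north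
  le_west : ℓ north ≤ ℓ west
  le_south : ℓ west ≤ ℓ south
  le_east : ℓ south ≤ ℓ east
  unmarked : (1, (dist x : ℤ)) ∉ P ∨ dist x = 0
  unopened : dist x ≤ ℓ north → x ≠ (0, (dist x : ℤ))

/-- The local part of the invariant. -/
def Good (x : ℤ × ℤ) (ℓ : Dir → ℕ) (P : Finset (ℤ × ℤ)) (q : Phase) (p : ℤ × ℤ) : Prop :=
  Located ℓ P q p ∧ (layer q p = dist x → Ahead x q p)

/-- The lengths of the rays after a step. -/
def lenStep (ℓ : Dir → ℕ) (q : Phase) (b : Bool) (d : Dir) : ℕ :=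
  if q = out d ∧ b = false then ℓ d + 1 else ℓ d

/-- Steps of the other ants only lengthen rays and add pheromones. -/
theorem Good.mono {x : ℤ × ℤ} {ℓ ℓ' : Dir → ℕ} {P P' : Finset (ℤ × ℤ)} {q : Phase} {p : ℤ × ℤ}
    (h : Good x ℓ P q p) (hℓ : ∀ d, ℓ d ≤ ℓ' d) (hP : P ⊆ P') : Good x ℓ' P' q p := by
  refine ⟨?_, h.2⟩
  have h1 := h.1
  have he := hℓ east
  have hs := hℓ south
  have hw := hℓ west
  have hn := hℓ north
  rcases q with _ | d | d | _ | _ | _ | _ | _ | d | d | _ | _ | _ | _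
  case descend => exact ⟨h1.1, h1.2.1, by have := h1.2.2.1; omega, hP h1.2.2.2⟩
  all_goals first
    | (simp only [Located] at h1 ⊢; omega)
    | (cases d <;> simp only [Located] at h1 ⊢ <;> omega)

-- Case analysis over phase and sensed bit. The northern ray is the shortest, so an exploration of
-- an opened layer meets a pheromone on every ray and turns there; `unopened` and `unmarked` keep
-- verification from entering layer `dist x` behind `x` or skipping it.
set_option maxHeartbeats 4000000 in
theorem Good.step {x : ℤ × ℤ} {ℓ : Dir → ℕ} {P : Finset (ℤ × ℤ)} {q : Phase} {p : ℤ × ℤ}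
    (h : Good x ℓ P q p) (hT : Trail x ℓ P) (hx : p ≠ x) (hD : 0 < dist x) :
    Good x (lenStep ℓ q (decide (p ∈ P)))
      (if (asyncFTAct q (decide (p ∈ P))).emit then insert p P else P)
      (asyncFTAct q (decide (p ∈ P))).next
      (p + ((asyncFTAct q (decide (p ∈ P))).move.map Dir.vec).getD 0) := by
  obtain ⟨a, b⟩ := p
  obtain ⟨h1, h2⟩ := h
  have hA := hT.axis a b
  have hO := hT.offAxis a b
  have h3 := hT.le_west
  have h4 := hT.le_south
  have h5 := hT.le_east
  have h7 := hT.unopened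
  have h8 : (a, b) ∈ P → a = 1 → b ≠ dist x := by
    rintro hm rfl rfl
    exact hT.unmarked.elim (fun h => h hm) hD.ne'
  have h9 : (a, b) ∈ P → a = 1 → (1, b) ∈ P := by
    rintro hm rfl
    exact hm
  have hdist : dist x = x.1.natAbs + x.2.natAbs := rfl
  obtain ⟨xa, xb⟩ := x
  unfold Good
  generalize dist (xa, xb) = D at *
  by_cases hb : (a, b) ∈ P
  all_goals
    simp only [hb, decide_true, decide_false, true_iff, false_iff, forall_true_left,
      IsEmpty.forall_iff, not_false_eq_true, ne_eq, Prod.mk.injEq] at *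
    rcases q with _ | d | d | _ | _ | _ | _ | _ | d | d | _ | _ | _ | _
  all_goals try cases d
  all_goals
    simp [Located, layer, Ahead, asyncFTAct, lenStep, Dir.vec, Dir.opp, Dir.cw] at h1 h2 hA hO h7 hx ⊢
    first
      | done
      | omega
      | exact ⟨⟨by omega, by omega, by omega, h9 (by omega)⟩, by omega⟩

/-- The pheromones after a step in the cell `p`. -/
def trailStep (P : Finset (ℤ × ℤ)) (q : Phase) (p : ℤ × ℤ) : Finset (ℤ × ℤ) :=
  if (asyncFTAct q (decide (p ∈ P))).emit then insert p P else P

/-- The cell of an ant after a step. -/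
def cellStep (P : Finset (ℤ × ℤ)) (q : Phase) (p : ℤ × ℤ) : ℤ × ℤ :=
  p + ((asyncFTAct q (decide (p ∈ P))).move.map Dir.vec).getD 0

/-- The phase of an ant after a step. -/
def phaseStep (P : Finset (ℤ × ℤ)) (q : Phase) (p : ℤ × ℤ) : Phase :=
  (asyncFTAct q (decide (p ∈ P))).next

theorem trailStep_of_emitting {P : Finset (ℤ × ℤ)} {q : Phase} {p : ℤ × ℤ}
    (hq : q = mark ∨ ∃ d, q = out d) : trailStep P q p = insert p P := by
  rcases hq with rfl | ⟨d, rfl⟩ <;> by_cases hb : p ∈ P <;> (try cases d) <;>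
    simp [trailStep, asyncFTAct, hb]

theorem trailStep_of_not_emitting {P : Finset (ℤ × ℤ)} {q : Phase} {p : ℤ × ℤ}
    (hq : ¬(q = mark ∨ ∃ d, q = out d)) : trailStep P q p = P := by
  rcases q with _ | d | d | _ | _ | _ | _ | _ | d | d | _ | _ | _ | _ <;>
    by_cases hb : p ∈ P <;> (try cases d) <;> simp_all [trailStep, asyncFTAct]

theorem mem_trailStep {P : Finset (ℤ × ℤ)} {q : Phase} {p r : ℤ × ℤ} :
    r ∈ trailStep P q p ↔ r ∈ P ∨ (r = p ∧ (q = mark ∨ ∃ d, q = out d)) := by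
  by_cases hq : q = mark ∨ ∃ d, q = out d
  · rw [trailStep_of_emitting hq, Finset.mem_insert]
    tauto
  · rw [trailStep_of_not_emitting hq]
    tauto

theorem subset_trailStep (P : Finset (ℤ × ℤ)) (q : Phase) (p : ℤ × ℤ) : P ⊆ trailStep P q p :=
  fun _ h => mem_trailStep.2 (Or.inl h)

theorem le_lenStep (ℓ : Dir → ℕ) (q : Phase) (b : Bool) (d : Dir) : ℓ d ≤ lenStep ℓ q b d := by
  unfold lenStep
  split_ifs <;> omega

/-- The order of the ray lengths is not a local fact, so it is assumed here; it comes from the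
balance of all ants' lags in `invariant`. -/
theorem Trail.step {x : ℤ × ℤ} {ℓ : Dir → ℕ} {P : Finset (ℤ × ℤ)} {q : Phase} {p : ℤ × ℤ}
    (hT : Trail x ℓ P) (h : Good x ℓ P q p) (hx : p ≠ x) (hD : 0 < dist x)
    (hw : lenStep ℓ q (decide (p ∈ P)) north ≤ lenStep ℓ q (decide (p ∈ P)) west)
    (hs : lenStep ℓ q (decide (p ∈ P)) west ≤ lenStep ℓ q (decide (p ∈ P)) south)
    (he : lenStep ℓ q (decide (p ∈ P)) south ≤ lenStep ℓ q (decide (p ∈ P)) east) :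
    Trail x (lenStep ℓ q (decide (p ∈ P))) (trailStep P q p) := by
  obtain ⟨a, b⟩ := p
  obtain ⟨h1, h2⟩ := h
  have hA0 := hT.axis a b
  refine ⟨?_, ?_, hw, hs, he, ?_, ?_⟩ <;> clear hw hs he
  · intro a' b' hab
    have hA := hT.axis a' b' hab
    by_cases hq : q = mark ∨ ∃ d, q = out d
    · rw [trailStep_of_emitting hq, Finset.mem_insert, Prod.mk.injEq, hA]
      clear hA h2 hx hD hT
      rcases hq with rfl | ⟨d, rfl⟩
      · simp only [Located] at h1
        simp only [lenStep, reduceCtorEq, false_and, if_false]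
        omega
      · by_cases hb : (a, b) ∈ P <;>
          simp only [hb, true_iff, false_iff] at hA0 <;> cases d <;>
          simp only [Located] at h1 <;>
          simp only [lenStep, hb, decide_true, decide_false, if_true, reduceCtorEq, out.injEq,
            and_true, and_false, if_false] <;>
          omega
    · rw [trailStep_of_not_emitting hq, hA]
      have : ∀ d, q ≠ out d := fun d h => hq (Or.inr ⟨d, h⟩)
      simp [lenStep, this]
  · intro a' b' ha hb' hm
    have hO := hT.offAxis a' b' ha hb'
    have h4 := le_lenStep ℓ q (decide ((a, b) ∈ P)) north
    rcases mem_trailStep.1 hm with h5 | ⟨h5, rfl | ⟨d, rfl⟩⟩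
    · have := hO h5; omega
    · simp only [Located] at h1; simp only [Prod.mk.injEq] at h5; omega
    · simp only [Prod.mk.injEq] at h5; cases d <;> simp only [Located] at h1 <;> omega
  · refine Or.inl fun hm => ?_
    rcases mem_trailStep.1 hm with h5 | ⟨h5, rfl | ⟨d, rfl⟩⟩
    · exact hT.unmarked.elim (fun h => h h5) hD.ne'
    -- An ant about to mark the layer of `x` would have `x` ahead, and `Ahead` is `False` in phase
    -- `mark`.
    · exact h2 (Prod.mk.inj h5).2.symm
    · simp only [Prod.mk.injEq] at h5; cases d <;> simp only [Located] at h1 <;> omega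
  · intro hn
    by_cases h3 : dist x ≤ ℓ north
    · exact hT.unopened h3
    · rintro hx'
      unfold lenStep at hn
      split_ifs at hn with h4
      -- The emitting ant stands on the new tip of the northern ray, which would be `x` itself.
      · obtain ⟨rfl, h4⟩ := h4
        simp only [Located] at h1
        simp only [decide_eq_false_iff_not] at h4
        rw [hA0 (Or.inl h1.1)] at h4
        apply hx
        rw [hx']
        ext <;> simp <;> omega
      · exact h3 hn

/-! ### Progress of an ant to its next exploration -/

theorem layer_phaseStep {x : ℤ × ℤ} {ℓ : Dir → ℕ} {P : Finset (ℤ × ℤ)} {q : Phase} {p : ℤ × ℤ}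
    (h : Located ℓ P q p) (hT : Trail x ℓ P) (hq : Exploring q) :
    (1, layer q p) ∈ trailStep P q p ∨
    (Exploring (phaseStep P q p) ∧ layer (phaseStep P q p) (cellStep P q p) = layer q p) := by
  obtain ⟨a, b⟩ := p
  have hA := hT.axis a b
  have hO := hT.offAxis a b
  have h3 := hT.le_west
  have h4 := hT.le_south
  have h5 := hT.le_east
  by_cases hm : q = mark
  · subst hm
    simp only [Located] at h
    left
    refine mem_trailStep.2 (Or.inr ⟨?_, Or.inl rfl⟩)
    ext <;> simp [layer, h.1]
  right
  unfold phaseStep cellStep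
  by_cases hb : (a, b) ∈ P
  all_goals
    simp only [hb, decide_true, decide_false, true_iff, false_iff, forall_true_left,
      IsEmpty.forall_iff, not_false_eq_true, ne_eq] at *
    rcases q with _ | d | d | _ | _ | _ | _ | _ | d | d | _ | _ | _ | _
  all_goals try cases d
  all_goals
    simp [Located, layer, Exploring, asyncFTAct, Dir.vec, Dir.cw]
      at h hA hO hq hm ⊢
    try omega

/-- A step that starts the exploration of a layer. -/
def Starts (P : Finset (ℤ × ℤ)) (q : Phase) (p : ℤ × ℤ) : Prop :=
  (q = out north ∨ q = check) ∧ p ∉ P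

/-- An upper bound on the number of steps until the next exploration starts, if all rays have length
at most `N`. -/
def fuel (N : ℕ) : Phase → ℤ × ℤ → ℤ
  | start, _ => 7 * N + 8
  | out east, p => 7 * N + 8 - p.1
  | back east, p => 5 * N + 6 + p.1
  | out south, p => 5 * N + 6 + p.2
  | back south, p => 3 * N + 4 - p.2
  | out west, p => 3 * N + 4 + p.1
  | back west, p => N + 2 - p.1
  | out north, p => N + 2 - p.2
  | back north, _ => 0
  | firstZig, p => 7 * N + 10 + 11 * p.2
  | firstPair, p => 7 * N + 9 + 11 * (p.2 + 1)
  | probe, p => 7 * N + 8 + 11 * (p.2 + 1)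
  | onMark, p => 7 * N + 6 + 11 * (p.2 + 1)
  | onRay, _ => 7 * N + 17
  | zig east, p => 7 * N + 7 + 9 * (p.1 + p.2 - 1) + 2 * p.2
  | pair east, p => 7 * N + 8 + 9 * (p.1 + p.2) + 2 * p.2
  | zig south, p => 7 * N + 7 + 7 * (p.1 - p.2 - 1) + 2 * p.1
  | pair south, p => 7 * N + 8 + 7 * (p.1 - p.2) + 2 * p.1
  | zig west, p => 7 * N + 7 + 5 * (-p.1 - p.2 - 1) - 2 * p.2
  | pair west, p => 7 * N + 8 + 5 * (-p.1 - p.2) - 2 * p.2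
  | zig north, p => 7 * N + 7 + 3 * (p.2 - p.1 - 1) - 2 * p.1
  | pair north, p => 7 * N + 8 + 3 * (p.2 - p.1) - 2 * p.1
  | mark, p => 7 * N + 7 + 3 * p.2
  | descend, p => 7 * N + 6 + 3 * p.2
  | verify, p => 7 * N + 8 + 3 * p.2
  | check, p => 7 * N + 7 + 3 * p.2

theorem fuel_bounds {ℓ : Dir → ℕ} {P : Finset (ℤ × ℤ)} {q : Phase} {p : ℤ × ℤ} {N : ℕ}
    (h : Located ℓ P q p) (hN : ∀ d, ℓ d ≤ N) : 0 < fuel N q p ∧ fuel N q p ≤ 18 * N + 10 := by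
  have he := hN east
  have hs := hN south
  have hw := hN west
  have hn := hN north
  rcases q with _ | d | d | _ | _ | _ | _ | _ | d | d | _ | _ | _ | _
  all_goals try cases d
  all_goals
    simp only [Located, fuel] at h ⊢
    try omega

-- The coefficients of `fuel` count remaining work: `7N` for seven ray traversals, `3` per layer of
-- the descent (verify, check, descend), and `8` per unit of the layer for the exploration, `2` for
-- each quadrant.
set_option maxHeartbeats 1000000 in
theorem fuel_phaseStep {x : ℤ × ℤ} {ℓ : Dir → ℕ} {P : Finset (ℤ × ℤ)} {q : Phase} {p : ℤ × ℤ}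
    {N : ℕ} (h : Located ℓ P q p) (hT : Trail x ℓ P) (hN : ∀ d, ℓ d ≤ N)
    (hq : ¬ Starts P q p) :
    fuel N (phaseStep P q p) (cellStep P q p) + 1 ≤ fuel N q p := by
  obtain ⟨a, b⟩ := p
  have hA := hT.axis a b
  have h3 := hT.le_west
  have h4 := hT.le_south
  have h5 := hT.le_east
  have he := hN east
  have hs := hN south
  have hw := hN west
  have hn := hN north
  unfold Starts at hq
  unfold phaseStep cellStep
  by_cases hb : (a, b) ∈ P
  all_goals
    simp only [hb, decide_true, decide_false, true_iff, false_iff, not_false_eq_true] at *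
    rcases q with _ | d | d | _ | _ | _ | _ | _ | d | d | _ | _ | _ | _
  all_goals try cases d
  all_goals
    simp [Located, fuel, asyncFTAct, Dir.vec, Dir.opp, Dir.cw]
      at h hA hq ⊢
    try omega

/-! ### Accounting of openings and of ray lengths -/

/-- The phases in which an ant works on a layer: exploration, completion mark, and verification. -/
def Working : Phase → Prop
  | start | out _ | back _ => False
  | _ => True

instance : DecidablePred Working := fun q => by
  cases q <;> unfold Working <;> infer_instance

/-- An upper bound, decreasing during the verification, on the layers on which a working ant can
still work before it returns to the nest; a layer that is yet to be checked is strictly below it. -/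
def top : Phase → ℤ × ℤ → ℤ
  | verify, p | check, p => p.2 + 1
  | q, p => layer q p

/-- The number of emissions of an ant on the ray `d` since its last emission on the northern ray. -/
def lag : Dir → Phase → ℕ
  | east, q => if q = back east ∨ q = out south ∨ q = back south ∨ q = out west ∨ q = back west ∨
      q = out north then 1 else 0
  | south, q => if q = back south ∨ q = out west ∨ q = back west ∨ q = out north then 1 else 0
  | west, q => if q = back west ∨ q = out north then 1 else 0
  | north, _ => 0

/-- The indicator of the ants that work on a layer from `D` on. -/
def busy (D : ℕ) (q : Phase) (p : ℤ × ℤ) : ℕ :=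
  if Working q ∧ (D : ℤ) ≤ layer q p then 1 else 0

/-- The quantity `ℓ d - ℓ north - lag d q` is conserved, since an ant emits on the rays in cyclic
order; the additive form avoids truncated subtraction. -/
theorem lag_phaseStep (ℓ : Dir → ℕ) (P : Finset (ℤ × ℤ)) (q : Phase) (p : ℤ × ℤ) (d : Dir) :
    lenStep ℓ q (decide (p ∈ P)) d + ℓ north + lag d q =
      ℓ d + lenStep ℓ q (decide (p ∈ P)) north + lag d (phaseStep P q p) := by
  unfold phaseStep
  by_cases hb : p ∈ P <;> simp only [hb, decide_true, decide_false] <;>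
  rcases q with _ | d' | d' | _ | _ | _ | _ | _ | d' | d' | _ | _ | _ | _ <;>
  cases d <;> (try cases d') <;> simp [lenStep, asyncFTAct, lag, Dir.cw, Dir.opp] <;> omega

theorem Starts.explores {P : Finset (ℤ × ℤ)} {q : Phase} {p : ℤ × ℤ} (h : Starts P q p) :
    Exploring (phaseStep P q p) ∧ layer (phaseStep P q p) (cellStep P q p) = p.2 := by
  obtain ⟨rfl | rfl, h⟩ := h <;>
    simp [phaseStep, cellStep, asyncFTAct, Exploring, layer, h, Dir.vec]

/-- Work begins only with an opening, and from there the ant only descends. -/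
theorem top_phaseStep {x : ℤ × ℤ} {ℓ : Dir → ℕ} {P : Finset (ℤ × ℤ)} {q : Phase} {p : ℤ × ℤ}
    (h : Located ℓ P q p) (hT : Trail x ℓ P) (hw : Working (phaseStep P q p)) :
    (q = out north ∧ p ∉ P ∧ top (phaseStep P q p) (cellStep P q p) = p.2) ∨
    (Working q ∧ top (phaseStep P q p) (cellStep P q p) ≤ top q p) := by
  obtain ⟨a, b⟩ := p
  have hA := hT.axis a b
  have hO := hT.offAxis a b
  have h3 := hT.le_west
  have h4 := hT.le_south
  have h5 := hT.le_east
  unfold phaseStep cellStep at *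
  by_cases hb : (a, b) ∈ P
  all_goals
    simp only [hb, decide_true, decide_false, true_iff, false_iff, forall_true_left,
      IsEmpty.forall_iff, not_false_eq_true, ne_eq] at *
    rcases q with _ | d | d | _ | _ | _ | _ | _ | d | d | _ | _ | _ | _
  all_goals try cases d
  all_goals
    simp [Located, layer, top, Working, asyncFTAct, Dir.vec, Dir.cw] at h hA hO hw ⊢
    try omega

/-- The northern ray grows either below layer `dist x` or by an ant that thereby becomes busy. A
busy ant stays busy, since leaving layer `dist x` downwards requires phase `descend` there, which
`Ahead` excludes. -/
theorem busy_phaseStep {x : ℤ × ℤ} {ℓ : Dir → ℕ} {P : Finset (ℤ × ℤ)} {q : Phase} {p : ℤ × ℤ}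
    (h : Good x ℓ P q p) (hT : Trail x ℓ P) (hD : 0 < dist x) :
    lenStep ℓ q (decide (p ∈ P)) north + 1 ≤ dist x ∧ lenStep ℓ q (decide (p ∈ P)) north ≠ ℓ north ∧
        busy (dist x) q p = 0 ∨
    lenStep ℓ q (decide (p ∈ P)) north + busy (dist x) q p ≤
      ℓ north + busy (dist x) (phaseStep P q p) (cellStep P q p) := by
  obtain ⟨a, b⟩ := p
  obtain ⟨h1, h2⟩ := h
  have hA := hT.axis a b
  have hO := hT.offAxis a b
  have h3 := hT.le_west
  have h4 := hT.le_south
  have h5 := hT.le_east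
  generalize dist x = D at *
  unfold phaseStep cellStep at *
  by_cases hb : (a, b) ∈ P
  all_goals
    simp only [hb, decide_true, decide_false, true_iff, false_iff, forall_true_left,
      IsEmpty.forall_iff, not_false_eq_true, ne_eq] at *
    rcases q with _ | d | d | _ | _ | _ | _ | _ | d | d | _ | _ | _ | _
  all_goals try cases d
  all_goals
    simp [Located, layer, busy, Ahead, Working, lenStep, asyncFTAct, Dir.vec, Dir.opp, Dir.cw]
      at h1 h2 hA hO ⊢
    try (repeat' split) <;> omega

/-! ### The global invariant along a run -/

variable {k f : ℕ} (A : Adversary k f)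

/-- The lengths of the rays after `t` steps. -/
def len : ℕ → Dir → ℕ
  | 0 => fun _ => 0
  | t + 1 => lenStep (len t) ((run asyncFT A t).state (A.ant t))
      (decide ((run asyncFT A t).pos (A.ant t) ∈ (run asyncFT A t).pheromones))

theorem state_succ (t : ℕ) : (run asyncFT A (t + 1)).state =
    Function.update (run asyncFT A t).state (A.ant t)
      (phaseStep (run asyncFT A t).pheromones ((run asyncFT A t).state (A.ant t))
        ((run asyncFT A t).pos (A.ant t))) := rfl

theorem pos_succ (t : ℕ) : (run asyncFT A (t + 1)).pos =
    Function.update (run asyncFT A t).pos (A.ant t)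
      (cellStep (run asyncFT A t).pheromones ((run asyncFT A t).state (A.ant t))
        ((run asyncFT A t).pos (A.ant t))) := rfl

theorem pheromones_succ (t : ℕ) : (run asyncFT A (t + 1)).pheromones =
    trailStep (run asyncFT A t).pheromones ((run asyncFT A t).state (A.ant t))
      ((run asyncFT A t).pos (A.ant t)) := rfl

theorem emissions_eq_card (t : ℕ) :
    (run asyncFT A t).emissions = (run asyncFT A t).pheromones.card := by
  induction t with
  | zero => rfl
  | succ t ih =>
    change (if (asyncFTAct ((run asyncFT A t).state (A.ant t)) (decide ((run asyncFT A t).pos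
        (A.ant t) ∈ (run asyncFT A t).pheromones))).emit then (run asyncFT A t).emissions + 1
      else (run asyncFT A t).emissions) = (trailStep (run asyncFT A t).pheromones
        ((run asyncFT A t).state (A.ant t)) ((run asyncFT A t).pos (A.ant t))).card
    unfold trailStep
    generalize (run asyncFT A t).state (A.ant t) = q
    generalize (run asyncFT A t).pos (A.ant t) = p
    by_cases hb : p ∈ (run asyncFT A t).pheromones
    · have : (asyncFTAct q true).emit = false := by
        rcases q with _ | d | d | _ | _ | _ | _ | _ | d | d | _ | _ | _ | _ <;>
          (try cases d) <;> rfl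
      simpa [hb, this] using ih
    · split_ifs
      · rw [Finset.card_insert_of_notMem hb, ih]
      · exact ih

/-- The invariant of the algorithm, as long as the cell `x` is not visited. -/
structure Invariant (x : ℤ × ℤ) (t : ℕ) : Prop where
  trail : Trail x (len A t) (run asyncFT A t).pheromones
  good : ∀ a, Good x (len A t) (run asyncFT A t).pheromones ((run asyncFT A t).state a)
    ((run asyncFT A t).pos a)
  lag : ∀ d, len A t d = len A t north + ∑ a, lag d ((run asyncFT A t).state a)
  north_lt : len A t north + 1 ≤
    dist x + ∑ a, busy (dist x) ((run asyncFT A t).state a) ((run asyncFT A t).pos a)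

theorem sum_step (t : ℕ) (F : Phase → ℤ × ℤ → ℕ) :
    ∑ a, F ((run asyncFT A (t + 1)).state a) ((run asyncFT A (t + 1)).pos a) +
      F ((run asyncFT A t).state (A.ant t)) ((run asyncFT A t).pos (A.ant t)) =
    ∑ a, F ((run asyncFT A t).state a) ((run asyncFT A t).pos a) +
      F ((run asyncFT A (t + 1)).state (A.ant t)) ((run asyncFT A (t + 1)).pos (A.ant t)) := by
  rw [← Finset.add_sum_erase _ _ (Finset.mem_univ (A.ant t)),
    ← Finset.add_sum_erase _ (fun a => F ((run asyncFT A t).state a) ((run asyncFT A t).pos a))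
      (Finset.mem_univ (A.ant t))]
  have : ∑ a ∈ Finset.univ.erase (A.ant t),
      F ((run asyncFT A (t + 1)).state a) ((run asyncFT A (t + 1)).pos a) =
      ∑ a ∈ Finset.univ.erase (A.ant t), F ((run asyncFT A t).state a) ((run asyncFT A t).pos a) := by
    refine Finset.sum_congr rfl fun a ha => ?_
    rw [state_succ, pos_succ, Function.update_of_ne (Finset.ne_of_mem_erase ha),
      Function.update_of_ne (Finset.ne_of_mem_erase ha)]
  rw [this]
  ring

theorem lag_le (q : Phase) : lag west q ≤ lag south q ∧ lag south q ≤ lag east q := by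
  rcases q with _ | d | d | _ | _ | _ | _ | _ | d | d | _ | _ | _ | _ <;> (try cases d) <;> decide

theorem invariant {x : ℤ × ℤ} (hD : 0 < dist x) (t : ℕ)
    (h : ∀ u < t, ¬ VisitsAt asyncFT A x u) : Invariant A x t := by
  induction t with
  | zero =>
    refine ⟨⟨?_, ?_, le_rfl, le_rfl, le_rfl, ?_, ?_⟩, ?_, ?_, ?_⟩
    · intro a b hab
      simp only [run, initConfig, len, Finset.notMem_empty, false_iff]
      omega
    · simp [run, initConfig]
    · simp [run, initConfig]
    · intro h0
      simp only [len] at h0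
      omega
    · intro a
      simp [Good, run, initConfig, Located, Ahead, asyncFT]
    · intro d
      have : lag d start = 0 := by cases d <;> rfl
      simp [run, initConfig, asyncFT, len, this]
    · simp only [len]
      omega
  | succ t ih =>
    have ih := ih fun u hu => h u (by omega)
    have hx : (run asyncFT A t).pos (A.ant t) ≠ x := h t (by omega)
    -- The lag balance comes first: with `lag_le` summed over the ants, it yields the order of the
    -- rays needed by `Trail.step`.
    have hlag : ∀ d, len A (t + 1) d = len A (t + 1) north +
        ∑ a, lag d ((run asyncFT A (t + 1)).state a) := by
      intro d
      have h1 := ih.lag d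
      have h2 := sum_step A t fun q _ => lag d q
      have h3 := lag_phaseStep (len A t) (run asyncFT A t).pheromones
        ((run asyncFT A t).state (A.ant t)) ((run asyncFT A t).pos (A.ant t)) d
      have h4 : (run asyncFT A (t + 1)).state (A.ant t) = _ :=
        (congrFun (state_succ A t) _).trans (Function.update_self ..)
      rw [← h4] at h3
      simp only [len] at *
      omega
    refine ⟨?_, ?_, hlag, ?_⟩
    · refine ih.trail.step (ih.good _) hx hD ?_ ?_ ?_
      · exact (Nat.le_add_right _ _).trans (hlag west).ge
      · have h1 := hlag west
        have h2 := hlag south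
        have := Finset.sum_le_sum (s := Finset.univ)
          fun a _ => (lag_le ((run asyncFT A (t + 1)).state a)).1
        show len A (t + 1) west ≤ len A (t + 1) south
        omega
      · have h1 := hlag south
        have h2 := hlag east
        have := Finset.sum_le_sum (s := Finset.univ)
          fun a _ => (lag_le ((run asyncFT A (t + 1)).state a)).2
        show len A (t + 1) south ≤ len A (t + 1) east
        omega
    · intro a
      by_cases ha : a = A.ant t
      · subst ha
        rw [state_succ, pos_succ, Function.update_self, Function.update_self]
        exact (ih.good _).step ih.trail hx hD
      · rw [state_succ, pos_succ, Function.update_of_ne ha, Function.update_of_ne ha]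
        exact (ih.good a).mono (fun d => le_lenStep ..) (subset_trailStep ..)
    · have h1 := busy_phaseStep (ih.good (A.ant t)) ih.trail hD
      have h2 := sum_step A t (busy (dist x))
      have h3 := ih.north_lt
      rw [state_succ A t, pos_succ A t, Function.update_self, Function.update_self,
        ← state_succ A t, ← pos_succ A t] at h2
      simp only [len]
      omega

/-! ### Starts and openings of layers -/

/-- The step number `t` starts the exploration of a layer. -/
def StartsAt (t : ℕ) : Prop :=
  Starts (run asyncFT A t).pheromones ((run asyncFT A t).state (A.ant t))
    ((run asyncFT A t).pos (A.ant t))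

/-- The step number `t` extends the northern ray. -/
def OpensAt (t : ℕ) : Prop :=
  (run asyncFT A t).state (A.ant t) = out north ∧
    (run asyncFT A t).pos (A.ant t) ∉ (run asyncFT A t).pheromones

/-- The layer whose exploration is started by the step number `t`. -/
def layerAt (t : ℕ) : ℤ := ((run asyncFT A t).pos (A.ant t)).2

variable {A}

theorem OpensAt.startsAt {t : ℕ} (h : OpensAt A t) : StartsAt A t := ⟨Or.inl h.1, h.2⟩

theorem len_mono (d : Dir) : Monotone fun t => len A t d :=
  monotone_nat_of_le_succ fun _ => le_lenStep ..

theorem pheromones_mono : Monotone fun t => (run asyncFT A t).pheromones :=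
  monotone_nat_of_le_succ fun _ => subset_trailStep ..

theorem lag_le_one (d : Dir) (q : Phase) : lag d q ≤ 1 := by
  cases d <;> simp only [lag] <;> (try split_ifs) <;> omega

theorem busy_le_one (D : ℕ) (q : Phase) (p : ℤ × ℤ) : busy D q p ≤ 1 := by
  unfold busy
  split_ifs <;> omega

theorem sum_le_of_le_one (g : Fin k → ℕ) (h : ∀ a, g a ≤ 1) : ∑ a, g a ≤ k := by
  simpa using Finset.sum_le_card_nsmul Finset.univ g 1 fun a _ => h a

theorem Invariant.len_le {x : ℤ × ℤ} {t : ℕ} (h : Invariant A x t) (d : Dir) :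
    len A t d ≤ dist x + 2 * k := by
  have h1 := h.lag d
  have h2 := h.north_lt
  have h3 := sum_le_of_le_one _ fun a => lag_le_one d ((run asyncFT A t).state a)
  have h4 := sum_le_of_le_one _ fun a =>
    busy_le_one (dist x) ((run asyncFT A t).state a) ((run asyncFT A t).pos a)
  omega

theorem state_succ_of_ne {t : ℕ} {a : Fin k} (h : A.ant t ≠ a) :
    (run asyncFT A (t + 1)).state a = (run asyncFT A t).state a := by
  rw [state_succ, Function.update_of_ne h.symm]

theorem pos_succ_of_ne {t : ℕ} {a : Fin k} (h : A.ant t ≠ a) :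
    (run asyncFT A (t + 1)).pos a = (run asyncFT A t).pos a := by
  rw [pos_succ, Function.update_of_ne h.symm]

theorem state_succ_self (t : ℕ) : (run asyncFT A (t + 1)).state (A.ant t) =
    phaseStep (run asyncFT A t).pheromones ((run asyncFT A t).state (A.ant t))
      ((run asyncFT A t).pos (A.ant t)) := by
  rw [state_succ, Function.update_self]

theorem pos_succ_self (t : ℕ) : (run asyncFT A (t + 1)).pos (A.ant t) =
    cellStep (run asyncFT A t).pheromones ((run asyncFT A t).state (A.ant t))
      ((run asyncFT A t).pos (A.ant t)) := by
  rw [pos_succ, Function.update_self]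

/-- The number of steps of the ant `a` before time `t`. -/
def steps (A : Adversary k f) (a : Fin k) (t : ℕ) : ℕ := Nat.count (fun u => A.ant u = a) t

theorem steps_succ (a : Fin k) (t : ℕ) :
    steps A a (t + 1) = steps A a t + if A.ant t = a then 1 else 0 := Nat.count_succ ..

section Unvisited

variable {x : ℤ × ℤ} {T : ℕ}

theorem fuel_add_steps_le (hI : ∀ t ≤ T, Invariant A x t) (a : Fin k) {u v : ℕ} (huv : u ≤ v)
    (hv : v ≤ T) (h : ∀ w, u ≤ w → w < v → A.ant w = a → ¬ StartsAt A w) :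
    fuel (dist x + 2 * k) ((run asyncFT A v).state a) ((run asyncFT A v).pos a) + steps A a v ≤
      fuel (dist x + 2 * k) ((run asyncFT A u).state a) ((run asyncFT A u).pos a) + steps A a u := by
  induction v, huv using Nat.le_induction with
  | base => exact le_rfl
  | succ v huv ih =>
    have ih := ih (by omega) fun w h1 h2 => h w h1 (by omega)
    rw [steps_succ]
    by_cases ha : A.ant v = a
    · have hs := h v huv (by omega) ha
      subst ha
      have hv' := hI v (by omega)
      rw [state_succ_self, pos_succ_self, if_pos rfl]
      have := fuel_phaseStep (hv'.good (A.ant v)).1 hv'.trail hv'.len_le hs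
      push_cast
      omega
    · rw [state_succ_of_ne ha, pos_succ_of_ne ha, if_neg ha]
      exact ih

theorem exists_startsAt (hI : ∀ t ≤ T, Invariant A x t) (a : Fin k) {u v : ℕ} (huv : u ≤ v)
    (hv : v ≤ T) (h : steps A a u + (18 * (dist x + 2 * k) + 10) ≤ steps A a v) :
    ∃ w, u ≤ w ∧ w < v ∧ A.ant w = a ∧ StartsAt A w := by
  by_contra! hc
  have h1 := fuel_add_steps_le hI a huv hv hc
  have h2 := (fuel_bounds ((hI v hv).good a).1 (hI v hv).len_le).1
  have h3 := (fuel_bounds ((hI u (by omega)).good a).1 (hI u (by omega)).len_le).2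
  push_cast at h1 h2 h3
  omega

theorem marked_or_exploring (hI : ∀ t ≤ T, Invariant A x t) {w t : ℕ} (hwt : w < t) (ht : t ≤ T)
    (hs : StartsAt A w) : (1, layerAt A w) ∈ (run asyncFT A t).pheromones ∨
      (Exploring ((run asyncFT A t).state (A.ant w)) ∧
        layer ((run asyncFT A t).state (A.ant w)) ((run asyncFT A t).pos (A.ant w)) =
          layerAt A w) := by
  induction t, hwt using Nat.le_induction with
  | base =>
    right
    rw [state_succ_self, pos_succ_self]
    exact hs.explores
  | succ t hwt ih =>
    rcases ih (by omega) with h | ⟨h1, h2⟩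
    · exact Or.inl (pheromones_mono (Nat.le_succ t) h)
    · by_cases ha : A.ant t = A.ant w
      · rw [← ha] at h1 h2 ⊢
        have ht' := hI t (by omega)
        have := layer_phaseStep (ht'.good _).1 ht'.trail h1
        rwa [h2, ← state_succ_self, ← pos_succ_self, ← pheromones_succ] at this
      · rw [state_succ_of_ne ha, pos_succ_of_ne ha]
        exact Or.inr ⟨h1, h2⟩

/-- A start happens in phase `out north` or `check`, neither of which is exploring, so the previous
exploration has ended with its mark present. -/
theorem marked_of_startsAt (hI : ∀ t ≤ T, Invariant A x t) {w w' : ℕ} (h : w < w') (hT : w' ≤ T)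
    (hs : StartsAt A w) (hs' : StartsAt A w') (ha : A.ant w = A.ant w') :
    (1, layerAt A w) ∈ (run asyncFT A w').pheromones := by
  refine (marked_or_exploring hI h hT hs).resolve_right fun hE => ?_
  have hE := hE.1
  rw [ha] at hE
  rcases hs'.1 with h1 | h1 <;> rw [h1] at hE <;> exact hE

theorem OpensAt.layerAt_eq {t : ℕ} (hI : Invariant A x t) (h : OpensAt A t) :
    layerAt A t = len A t north + 1 ∧ len A (t + 1) north = len A t north + 1 := by
  have h1 := (hI.good (A.ant t)).1
  rw [h.1] at h1
  have h2 := h.2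
  obtain ⟨h3, h4, h5⟩ := h1
  rw [← Prod.mk.eta (p := (run asyncFT A t).pos (A.ant t)), hI.trail.axis _ _ (Or.inl h3)] at h2
  constructor
  · unfold layerAt
    omega
  · simp [len, lenStep, h.1, h.2]

theorem StartsAt.layerAt_bounds {t : ℕ} (hI : Invariant A x t) (h : StartsAt A t) :
    1 ≤ layerAt A t ∧ layerAt A t ≤ len A (t + 1) north := by
  obtain ⟨h1 | h1, h2⟩ := h
  · have h3 := OpensAt.layerAt_eq hI ⟨h1, h2⟩
    rw [h3.1, h3.2]
    omega
  · have h3 := (hI.good (A.ant t)).1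
    rw [h1] at h3
    have : len A t north ≤ len A (t + 1) north := len_mono north (Nat.le_succ t)
    obtain ⟨_, h4, h5⟩ := h3
    unfold layerAt
    omega

/-- By the second start the layer is marked and lies within the northern ray, so it can be neither
opened again nor found unmarked. -/
theorem startsAt_unique (hI : ∀ t ≤ T, Invariant A x t) {w w' : ℕ} (hT : w ≤ T) (hT' : w' ≤ T)
    (hs : StartsAt A w) (hs' : StartsAt A w') (ha : A.ant w = A.ant w')
    (hl : layerAt A w = layerAt A w') : w = w' := by
  wlog h : w < w' generalizing w w'
  · by_contra hne
    exact hne (this hT' hT hs' hs ha.symm hl.symm (by omega)).symm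
  exfalso
  have hm := marked_of_startsAt hI h hT' hs hs' ha
  have hb := hs.layerAt_bounds (hI w hT)
  have hmono : len A (w + 1) north ≤ len A w' north := len_mono north h
  have hI' := hI w' hT'
  rcases hs'.1 with h1 | h1
  · have := OpensAt.layerAt_eq hI' ⟨h1, hs'.2⟩
    omega
  · have h3 := (hI'.good (A.ant w')).1
    rw [h1] at h3
    apply hs'.2
    rw [hl] at hm
    convert hm using 1
    exact Prod.ext h3.1 rfl

theorem opensAt_unique (hI : ∀ t ≤ T, Invariant A x t) {u v : ℕ} (hu : u ≤ T) (hv : v ≤ T)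
    (h : OpensAt A u) (h' : OpensAt A v) (hl : layerAt A v ≤ layerAt A u) : v ≤ u := by
  by_contra! hc
  have h1 := h.layerAt_eq (hI u hu)
  have h2 := h'.layerAt_eq (hI v hv)
  have h3 : len A (u + 1) north ≤ len A v north := len_mono north hc
  omega

theorem exists_opensAt (hI : ∀ t ≤ T, Invariant A x t) {t : ℕ} (ht : t ≤ T) {m : ℤ} (h1 : 1 ≤ m)
    (h2 : m ≤ len A t north) : ∃ u < t, OpensAt A u ∧ layerAt A u = m := by
  induction t with
  | zero => simp only [len] at h2; omega
  | succ t ih =>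
    by_cases h3 : m ≤ len A t north
    · obtain ⟨u, hu, h⟩ := ih (by omega) h3
      exact ⟨u, by omega, h⟩
    · have ho : OpensAt A t := by
        by_contra hno
        have : len A (t + 1) north = len A t north := by
          simp only [len, lenStep, ite_eq_right_iff, decide_eq_false_iff_not]
          exact fun h => absurd h hno
        rw [this] at h2
        exact h3 h2
      have h4 := ho.layerAt_eq (hI t (by omega))
      exact ⟨t, by omega, ho, by omega⟩

theorem exists_opensAt_of_working (hI : ∀ t ≤ T, Invariant A x t) {t : ℕ} (ht : t ≤ T) (a : Fin k)
    (h : Working ((run asyncFT A t).state a)) : ∃ v < t, A.ant v = a ∧ OpensAt A v ∧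
      top ((run asyncFT A t).state a) ((run asyncFT A t).pos a) ≤ layerAt A v := by
  induction t with
  | zero => exact h.elim
  | succ t ih =>
    by_cases ha : A.ant t = a
    · subst ha
      rw [state_succ_self] at h
      rw [state_succ_self, pos_succ_self]
      have hI' := hI t (by omega)
      rcases top_phaseStep (hI'.good _).1 hI'.trail h with ⟨h1, h2, h3⟩ | ⟨h1, h2⟩
      · exact ⟨t, by omega, rfl, ⟨h1, h2⟩, h3.le⟩
      · obtain ⟨v, hv, h3, h4, h5⟩ := ih (by omega) h1
        exact ⟨v, by omega, h3, h4, h2.trans h5⟩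
    · rw [state_succ_of_ne ha] at h ⊢
      rw [pos_succ_of_ne ha]
      obtain ⟨v, hv, h3⟩ := ih (by omega) h
      exact ⟨v, by omega, h3⟩

/-- The exploration of a layer that was opened before is preceded by the opening of a higher layer by
the same ant, and the completion mark of the layer is missing. -/
theorem StartsAt.opensAt_or (hI : ∀ t ≤ T, Invariant A x t) {w : ℕ} (hw : w ≤ T)
    (h : StartsAt A w) : OpensAt A w ∨
      ((1, layerAt A w) ∉ (run asyncFT A w).pheromones ∧
      ∃ u v, u < v ∧ v < w ∧ OpensAt A u ∧ OpensAt A v ∧ layerAt A u = layerAt A w ∧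
        A.ant v = A.ant w) := by
  rcases h.1 with h1 | h1
  · exact Or.inl ⟨h1, h.2⟩
  · right
    have hI' := hI w hw
    have hg := (hI'.good (A.ant w)).1
    obtain ⟨v, hvw, hv1, hv2, hv3⟩ := exists_opensAt_of_working hI hw (A.ant w) (by rw [h1]; trivial)
    rw [h1] at hg hv3
    -- In phase `check`, `top` exceeds the layer by one, so the layer opened at `v` is strictly
    -- higher; layers open in order, hence `u < v`.
    have hv3 : layerAt A w + 1 ≤ layerAt A v := hv3
    have hv4 := hv2.layerAt_eq (hI v (by omega))
    obtain ⟨u, huv, hu1, hu2⟩ := exists_opensAt hI (t := v) (m := layerAt A w) (by omega) hg.2.1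
      (by omega)
    refine ⟨?_, u, v, huv, hvw, hu1, hv2, hu2, hv1⟩
    convert h.2 using 1
    have : (run asyncFT A w).pos (A.ant w) = (1, layerAt A w) := Prod.ext hg.1 rfl
    rw [this]

end Unvisited

theorem window_unique {τ : ℕ → ℕ} (hτ : Monotone τ) {i j w : ℕ} (h1 : τ i ≤ w) (h2 : w < τ (i + 1))
    (h3 : τ j ≤ w) (h4 : w < τ (j + 1)) : i = j := by
  rcases lt_trichotomy i j with h | h | h
  · have := hτ (show i + 1 ≤ j from h); omega
  · exact h
  · have := hτ (show j + 1 ≤ i from h); omega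

/-! ### Termination by pigeonhole on layers -/

section Termination

variable {x : ℤ × ℤ}

theorem exists_visitsAt (hD : 0 < dist x) : ∃ t, VisitsAt asyncFT A x t := by
  by_contra! hc
  have hI : ∀ t, Invariant A x t := fun t => invariant A hD t fun u _ => hc u
  obtain ⟨a, ha⟩ := Finite.exists_infinite_fiber A.ant
  have ha : (Set.ofPred fun u => A.ant u = a).Infinite := Set.infinite_coe_iff.1 ha
  have hsurj := Nat.surjective_count_of_infinite_setOfPred ha
  set N := dist x + 2 * k with hN
  -- Some ant `a` moves infinitely often; `τ j` cuts its steps into blocks of `18N + 10`, each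
  -- containing a start.
  choose τ hτ using fun j : ℕ => hsurj (j * (18 * N + 10))
  have hτ : ∀ j, steps A a (τ j) = j * (18 * N + 10) := hτ
  have hsmono : Monotone (steps A a) := Nat.count_monotone _
  have hmono : Monotone τ := by
    refine monotone_nat_of_le_succ fun j => ?_
    by_contra! hlt
    have h1 := hsmono hlt.le
    rw [hτ, hτ] at h1
    have : (j + 1) * (18 * N + 10) = j * (18 * N + 10) + (18 * N + 10) := by ring
    omega
  have hex : ∀ j, ∃ w, τ j ≤ w ∧ w < τ (j + 1) ∧ A.ant w = a ∧ StartsAt A w := fun j =>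
    exists_startsAt (fun t _ => hI t) a (hmono (Nat.le_succ j)) le_rfl (by
      rw [hτ, hτ, ← hN]; exact (by ring : _ = _).le)
  choose w hw1 hw2 hw3 hw4 using hex
  have hinj : Set.InjOn (fun j => layerAt A (w j)) (Finset.range (N + 1) : Set ℕ) := by
    intro i _ j _ hij
    have := startsAt_unique (T := max (w i) (w j)) (fun t _ => hI t) (le_max_left ..)
      (le_max_right ..) (hw4 i) (hw4 j) ((hw3 i).trans (hw3 j).symm) hij
    exact window_unique hmono (hw1 i) (hw2 i) (this ▸ hw1 j) (this ▸ hw2 j)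
  have hcard := Finset.card_le_card_of_injOn (t := Finset.Icc (1 : ℤ) N) _ (fun j _ => by
    have h1 := (hw4 j).layerAt_bounds (hI _)
    have h2 := (hI (w j + 1)).len_le north
    simp only [Finset.coe_Icc, Set.mem_Icc]
    omega) hinj
  simp at hcard

end Termination

/-! ### Rounds and phases -/

section Rounds

-- The slack `1` covers a round already under way at `u`, in which `a` may have moved before `u`.
open Classical in
theorem steps_add_round_le (a : Fin k) {u v : ℕ} (huv : u ≤ v) :
    A.failTime a ≤ v ∨
      steps A a u + (roundState A v).1 + (if a ∈ (roundState A v).2 then 1 else 0) ≤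
        steps A a v + (roundState A u).1 + 1 := by
  induction v, huv using Nat.le_induction with
  | base => right; split_ifs <;> omega
  | succ v huv ih =>
    by_cases hf : A.failTime a ≤ ((v + 1 : ℕ) : ℕ∞)
    · exact Or.inl hf
    right
    have hf' : ¬ A.failTime a ≤ v := fun h => hf (h.trans (by exact_mod_cast Nat.le_succ v))
    have ih := ih.resolve_left hf'
    rw [steps_succ]
    simp only [roundState]
    by_cases ha : A.ant v = a
    · rw [if_pos ha]
      split_ifs at * <;> simp_all <;> omega
    · rw [if_neg ha]
      have hmem : a ∈ insert (A.ant v) (roundState A v).2 ↔ a ∈ (roundState A v).2 := by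
        rw [Finset.mem_insert, or_iff_right fun h => ha h.symm]
      by_cases hR : ∀ b, b ∈ insert (A.ant v) (roundState A v).2 ∨
          A.failTime b ≤ ((v + 1 : ℕ) : ℕ∞)
      · rw [if_pos (hmem.1 ((hR a).resolve_right hf))] at ih
        simp only [if_pos hR, Finset.notMem_empty, if_false]
        omega
      · simp only [if_neg hR, hmem]
        omega

theorem round_succ_le (t : ℕ) : (roundState A t).1 ≤ (roundState A (t + 1)).1 ∧
    (roundState A (t + 1)).1 ≤ (roundState A t).1 + 1 := by
  simp only [roundState]
  split_ifs <;> simp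

theorem round_mono : Monotone fun t => (roundState A t).1 :=
  monotone_nat_of_le_succ fun t => (round_succ_le t).1

theorem exists_round_eq {t j : ℕ} (hj : j ≤ (roundState A t).1) :
    ∃ s ≤ t, (roundState A s).1 = j := by
  induction t with
  | zero => exact ⟨0, le_rfl, by simp only [roundState] at hj ⊢; omega⟩
  | succ t ih =>
    by_cases h : j ≤ (roundState A t).1
    · obtain ⟨s, hs, h⟩ := ih h
      exact ⟨s, by omega, h⟩
    · exact ⟨t + 1, le_rfl, by have := (round_succ_le (A := A) t).2; omega⟩

/-- Time can be divided into phases of `L + 1` rounds, in which every ant that does not fail makes at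
least `L` steps. -/
theorem exists_phases (A : Adversary k f) (T L : ℕ) : ∃ τ : ℕ → ℕ, Monotone τ ∧ (∀ p, τ p ≤ T) ∧
    ∀ p < (roundState A T).1 / (L + 1), ∀ a,
      A.failTime a ≤ τ (p + 1) ∨ steps A a (τ p) + L ≤ steps A a (τ (p + 1)) := by
  set P := (roundState A T).1 / (L + 1) with hP
  have hex : ∀ j, ∃ s ≤ T, (roundState A s).1 = min j (roundState A T).1 := fun j =>
    exists_round_eq (min_le_right _ _)
  choose σ hσ1 hσ2 using hex
  have hσ : ∀ p ≤ P, (roundState A (σ (p * (L + 1)))).1 = p * (L + 1) := fun p hp => by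
    rw [hσ2, min_eq_left]
    exact (Nat.mul_le_mul_right _ hp).trans (Nat.div_mul_le_self ..)
  have hmono : ∀ p q, p ≤ q → q ≤ P → σ (p * (L + 1)) ≤ σ (q * (L + 1)) := fun p q hpq hq => by
    by_contra! hc
    have h1 : (roundState A (σ (q * (L + 1)))).1 ≤ (roundState A (σ (p * (L + 1)))).1 :=
      round_mono hc.le
    rw [hσ q hq, hσ p (hpq.trans hq)] at h1
    rw [le_antisymm hpq (Nat.le_of_mul_le_mul_right h1 (Nat.succ_pos L))] at hc
    exact lt_irrefl _ hc
  refine ⟨fun p => σ (min p P * (L + 1)), fun p q h => hmono _ _ (min_le_min_right _ h)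
    (min_le_right ..), fun p => hσ1 _, fun p hp a => ?_⟩
  beta_reduce
  rw [min_eq_left hp.le, min_eq_left (show p + 1 ≤ P from hp)]
  refine (steps_add_round_le a (hmono p (p + 1) (Nat.le_succ p) hp)).imp_right fun h => ?_
  rw [hσ p hp.le, hσ (p + 1) hp] at h
  have h1 : (p + 1) * (L + 1) = p * (L + 1) + (L + 1) := by ring
  rw [h1] at h ⊢
  omega

end Rounds

/-! ### Counting pairs of a phase and a never-failing ant -/

section Counting

variable {x : ℤ × ℤ} {T : ℕ}

/-- The opener of a layer that is unmarked in a later phase has failed. -/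
theorem failTime_le_of_unmarked (hI : ∀ t ≤ T, Invariant A x t) {u s s' w : ℕ} (hu : OpensAt A u)
    (hus : u < s) (hss : s ≤ s') (hsw : s' ≤ w) (hw : w ≤ T)
    (hm : (1, layerAt A u) ∉ (run asyncFT A w).pheromones)
    (hs : A.failTime (A.ant u) ≤ s' ∨
      steps A (A.ant u) s + (18 * (dist x + 2 * k) + 10) ≤ steps A (A.ant u) s') :
    A.failTime (A.ant u) ≤ s' := by
  refine hs.resolve_right fun hs => hm ?_
  obtain ⟨v, hv1, hv2, hv3, hv4⟩ := exists_startsAt hI _ hss (hsw.trans hw) hs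
  exact pheromones_mono (by omega) (marked_of_startsAt hI (w' := v) (by omega) (by omega)
    hu.startsAt hv4 hv3.symm)

/-- An ant that fails leaves at most one layer unmarked. -/
theorem unmarked_unique (hI : ∀ t ≤ T, Invariant A x t) {u u' w w' : ℕ} (hw : w ≤ T) (hw' : w' ≤ T)
    (hu : OpensAt A u) (hu' : OpensAt A u') (ha : A.ant u = A.ant u')
    (hf : A.failTime (A.ant u) ≤ w) (hf' : A.failTime (A.ant u') ≤ w')
    (hm : (1, layerAt A u) ∉ (run asyncFT A w).pheromones)
    (hm' : (1, layerAt A u') ∉ (run asyncFT A w').pheromones) : u = u' := by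
  wlog h : u < u' generalizing u u' w w'
  · by_contra hne
    exact hne (this hw' hw hu' hu ha.symm hf' hf hm' hm (by omega)).symm
  have h1 : u' < w := by
    have := (A.alive u').trans_le (ha ▸ hf)
    exact_mod_cast this
  exact absurd (pheromones_mono h1.le
    (marked_of_startsAt hI h (by omega) hu.startsAt hu'.startsAt ha)) hm

open Classical in
theorem card_phases_le (hI : ∀ t ≤ T, Invariant A x t) {τ : ℕ → ℕ} (hτ : Monotone τ)
    (hT : ∀ p, τ p ≤ T) {P : ℕ} (hs : ∀ p < P + 1, ∀ a, A.failTime a ≤ τ (p + 1) ∨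
      steps A a (τ p) + (18 * (dist x + 2 * k) + 10) ≤ steps A a (τ (p + 1))) :
    P * (Finset.univ.filter fun a => A.failTime a = ⊤).card ≤ 2 * (dist x + 2 * k) +
      (Finset.univ.filter fun a => A.failTime a = ⊤).card *
      (Finset.univ.filter fun a => A.failTime a ≠ ⊤).card := by
  set G := Finset.univ.filter fun a => A.failTime a = ⊤ with hG
  set F := Finset.univ.filter fun a => A.failTime a ≠ ⊤ with hF
  set N := dist x + 2 * k with hN
  have hex : ∀ y : ℕ × Fin k, ∃ w, y ∈ Finset.range P ×ˢ G →
      τ (y.1 + 1) ≤ w ∧ w < τ (y.1 + 1 + 1) ∧ A.ant w = y.2 ∧ StartsAt A w := by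
    intro y
    by_cases hy : y ∈ Finset.range P ×ˢ G
    · rw [Finset.mem_product, Finset.mem_range, hG, Finset.mem_filter] at hy
      have h1 := hs (y.1 + 1) (by omega) y.2
      rw [hy.2.2] at h1
      obtain ⟨w, hw⟩ := exists_startsAt hI y.2 (hτ (Nat.le_succ _)) (hT _)
        (h1.resolve_left (by simp))
      exact ⟨w, fun _ => hw⟩
    · exact ⟨0, fun h => absurd h hy⟩
  choose w hw using hex
  have hwT : ∀ y ∈ Finset.range P ×ˢ G, w y < T := fun y hy => (hw y hy).2.1.trans_le (hT _)
  -- The ant opens a layer in phase `y.1` or the next; the start `w y` lies in the latter.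
  let S (y : ℕ × Fin k) (v : ℕ) : Prop :=
    τ y.1 ≤ v ∧ v < τ (y.1 + 1 + 1) ∧ A.ant v = y.2 ∧ OpensAt A v
  have hS1 : ((Finset.range P ×ˢ G).filter fun y => ∃ v, S y v).card ≤ 2 * N := by
    have hex : ∀ y : ℕ × Fin k, ∃ v, (∃ v, S y v) → S y v := fun y => by
      by_cases h : ∃ v, S y v
      · exact ⟨h.choose, fun _ => h.choose_spec⟩
      · exact ⟨0, fun h' => absurd h' h⟩
    choose v hv using hex
    have : ((Finset.range N) ×ˢ (Finset.univ : Finset Bool)).card = 2 * N := by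
      rw [Finset.card_product, Finset.card_range, Finset.card_univ, Fintype.card_bool, mul_comm]
    rw [← this]
    -- The length of the northern ray identifies the opening, hence the ant; the bit tells which of
    -- the two phases contains it.
    refine Finset.card_le_card_of_injOn
      (fun y => (len A (v y) north, decide (v y < τ (y.1 + 1)))) ?_ ?_
    · intro y hy
      obtain ⟨-, h2⟩ := Finset.mem_filter.1 hy
      obtain ⟨-, h3, -, h5⟩ := hv y h2
      have h6 := h3.trans_le (hT _)
      have h7 := (h5.layerAt_eq (hI _ h6.le)).2
      have h8 := (hI _ h6).len_le north
      simp only [Finset.coe_product, Set.mem_prod, Finset.mem_coe, Finset.mem_range,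
        Finset.mem_univ, and_true]
      rw [Nat.succ_eq_add_one] at h8
      omega
    · intro y hy z hz hyz
      obtain ⟨-, h2⟩ := Finset.mem_filter.1 hy
      obtain ⟨-, h2'⟩ := Finset.mem_filter.1 hz
      obtain ⟨h3, h4, h5, h6⟩ := hv y h2
      obtain ⟨h3', h4', h5', h6'⟩ := hv z h2'
      obtain ⟨h7, h8⟩ := Prod.mk.inj hyz
      have h9 := h4.le.trans (hT _)
      have h9' := h4'.le.trans (hT _)
      have h10 := (h6.layerAt_eq (hI _ h9)).1
      have h10' := (h6'.layerAt_eq (hI _ h9')).1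
      have hvv : v y = v z := le_antisymm (opensAt_unique hI h9' h9 h6' h6 (by omega))
        (opensAt_unique hI h9 h9' h6 h6' (by omega))
      refine Prod.ext ?_ (by rw [← h5, ← h5', hvv])
      rw [hvv] at h3 h4 h8
      by_cases h11 : v z < τ (z.1 + 1)
      · rw [decide_eq_true h11, decide_eq_true_iff] at h8
        exact window_unique hτ h3 h8 h3' h11
      · rw [decide_eq_false h11, decide_eq_false_iff_not] at h8
        have := window_unique hτ (not_lt.1 h8) h4 (not_lt.1 h11) h4'
        omega
  have hS2 : ((Finset.range P ×ˢ G).filter fun y => ¬ ∃ v, S y v).card ≤ G.card * F.card := by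
    have hex : ∀ y : ℕ × Fin k, ∃ u, y ∈ Finset.range P ×ˢ G → (¬ ∃ v, S y v) →
        OpensAt A u ∧ layerAt A u = layerAt A (w y) ∧ A.failTime (A.ant u) ≤ w y ∧
        (1, layerAt A u) ∉ (run asyncFT A (w y)).pheromones := by
      intro y
      by_cases hy : y ∈ Finset.range P ×ˢ G ∧ ¬ ∃ v, S y v
      · obtain ⟨h1, h2, h3, h4⟩ := hw y hy.1
        have hp : y.1 < P := Finset.mem_range.1 (Finset.mem_product.1 hy.1).1
        have h12 := hτ (Nat.le_succ y.1)
        have h5 := (hwT y hy.1).le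
        rcases h4.opensAt_or hI h5 with h6 | ⟨h6, u, v, huv, hvw, hu, hv, hl, ha⟩
        · exact absurd ⟨w y, h12.trans h1, h2, h3, h6⟩ hy.2
        · refine ⟨u, fun _ _ => ⟨hu, hl, ?_, hl ▸ h6⟩⟩
          -- Thus `u < v` also precedes phase `y.1`, and the opener of the layer had that whole
          -- phase to mark it.
          have hvτ : v < τ y.1 := by
            by_contra! hc
            exact hy.2 ⟨v, hc, hvw.trans h2, ha.trans h3, hv⟩
          refine (failTime_le_of_unmarked hI hu (huv.trans hvτ) h12 h1 h5 (hl ▸ h6)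
            (hs y.1 (by omega) _)).trans ?_
          exact_mod_cast h1
      · exact ⟨0, fun h h' => absurd ⟨h, h'⟩ hy⟩
    choose u hu using hex
    rw [← Finset.card_product]
    -- The failed opener determines its single unmarked layer; with the ant `y.2` this determines
    -- the start `w y`, hence the phase.
    refine Finset.card_le_card_of_injOn (fun y => (y.2, A.ant (u y))) ?_ ?_
    · intro y hy
      obtain ⟨h1, h2⟩ := Finset.mem_filter.1 hy
      obtain ⟨h3, h4, h5, h6⟩ := hu y h1 h2
      refine Finset.mem_product.2 ⟨(Finset.mem_product.1 h1).2, ?_⟩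
      rw [hF, Finset.mem_filter]
      refine ⟨Finset.mem_univ _, fun h => ?_⟩
      simp only [h, top_le_iff] at h5
      exact ENat.natCast_ne_top _ h5
    · intro y hy z hz hyz
      obtain ⟨h1, h2⟩ := Finset.mem_filter.1 hy
      obtain ⟨h1', h2'⟩ := Finset.mem_filter.1 hz
      obtain ⟨h3, h4, h5, h6⟩ := hu y h1 h2
      obtain ⟨h3', h4', h5', h6'⟩ := hu z h1' h2'
      obtain ⟨h7, h8⟩ := Prod.mk.inj hyz
      have huu := unmarked_unique hI (hwT y h1).le (hwT z h1').le h3 h3' h8 h5 h5' h6 h6'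
      obtain ⟨h9, h10, h11, h12⟩ := hw y h1
      obtain ⟨h9', h10', h11', h12'⟩ := hw z h1'
      have hww := startsAt_unique hI (hwT y h1).le (hwT z h1').le h12 h12'
        (by rw [h11, h11', h7]) (by rw [← h4, ← h4', huu])
      rw [hww] at h9 h10
      have := window_unique hτ h9 h10 h9' h10'
      exact Prod.ext (by omega) h7
  have := Finset.card_filter_add_card_filter_not (s := Finset.range P ×ˢ G) fun y => ∃ v, S y v
  rw [Finset.card_product, Finset.card_range] at this
  omega

end Counting

/-! ### Bounds on emissions and rounds -/

theorem Invariant.card_pheromones_le {x : ℤ × ℤ} {t N : ℕ} (hI : Invariant A x t)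
    (hN : ∀ d, len A t d ≤ N) : (run asyncFT A t).pheromones.card ≤ 3 * (2 * N + 1) := by
  have hsub : (run asyncFT A t).pheromones ⊆
      ((Finset.Icc (-N : ℤ) N) ×ˢ {0}) ∪ ({0} ×ˢ (Finset.Icc (-N : ℤ) N)) ∪
        ({1} ×ˢ (Finset.Icc (-N : ℤ) N)) := by
    rintro ⟨a, b⟩ hm
    have he := hN east
    have hs := hN south
    have hw := hN west
    have hn := hN north
    simp only [Finset.mem_union, Finset.mem_product, Finset.mem_Icc, Finset.mem_singleton]
    by_cases hab : a = 0 ∨ b = 0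
    · have := (hI.trail.axis a b hab).1 hm
      omega
    · have := hI.trail.offAxis a b (fun h => hab (Or.inl h)) (fun h => hab (Or.inr h)) hm
      omega
  refine (Finset.card_le_card hsub).trans ?_
  refine (Finset.card_union_le ..).trans ((Nat.add_le_add_right (Finset.card_union_le ..) _).trans ?_)
  simp only [Finset.card_product, Int.card_Icc, Finset.card_singleton]
  omega

open Classical in
theorem round_bound {x : ℤ × ℤ} {t : ℕ} (hf : f < k) (hk : k ≤ dist x) (hD : 0 < dist x)
    (hI : ∀ u ≤ t, Invariant A x u) :
    (roundOf A t : ℝ) ≤ 390 * ((dist x : ℝ) + (dist x : ℝ) ^ 2 / ((k : ℝ) - f) + dist x * f) := by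
  obtain ⟨τ, hτ, hT, hs⟩ := exists_phases A t (18 * (dist x + 2 * k) + 10)
  set L := 18 * (dist x + 2 * k) + 10 with hL
  set R := (roundState A t).1 with hR
  set P := R / (L + 1) with hP
  set g := (Finset.univ.filter fun a => A.failTime a = ⊤).card with hg
  have hF : (Finset.univ.filter fun a => A.failTime a ≠ ⊤).card ≤ f := by
    refine le_trans (le_of_eq ?_) A.card_fail_le
    rw [← Set.ncard_coe_finset]
    congr 1
    ext a
    simp
  have hgF : k ≤ g + f := by
    have := Finset.card_filter_add_card_filter_not (s := (Finset.univ : Finset (Fin k)))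
      fun a => A.failTime a = ⊤
    rw [Finset.card_univ, Fintype.card_fin] at this
    exact this.symm.le.trans (Nat.add_le_add_left hF _)
  have hmain : (P - 1) * g ≤ 6 * dist x + g * f := by
    rcases Nat.eq_zero_or_pos P with h0 | h0
    · simp [h0]
    · have h1 := card_phases_le hI hτ hT (P := P - 1) fun p hp => hs p (by omega)
      rw [← hg] at h1
      have h2 := Nat.mul_le_mul_left g hF
      omega
  -- Since `k ≤ dist x`, `L + 1 ≤ 54 * dist x + 11 ≤ 65 * dist x`.
  have hRP : R + 1 ≤ (P + 1) * (65 * dist x) := by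
    have h1 : R < (P + 1) * (L + 1) := by
      have := Nat.lt_div_mul_add (a := R) (b := L + 1) (Nat.succ_pos L)
      rw [← hP] at this
      rw [add_mul, one_mul]
      exact this
    exact h1.trans_le (Nat.mul_le_mul_left _ (by omega))
  have hkf : (0 : ℝ) < (k : ℝ) - f := by
    rw [sub_pos]
    exact_mod_cast hf
  have hgk : (k : ℝ) - f ≤ g := by
    rw [sub_le_iff_le_add]
    exact_mod_cast hgF
  have hg0 : (0 : ℝ) < g := hkf.trans_le hgk
  have hD' : (1 : ℝ) ≤ dist x := by exact_mod_cast hD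
  have h1 : (P : ℝ) - 1 ≤ 6 * (dist x / ((k : ℝ) - f)) + f := by
    have h2 : ((P : ℝ) - 1) * g ≤ 6 * dist x + g * f := by
      have h3 : (P : ℝ) - 1 ≤ ((P - 1 : ℕ) : ℝ) := by
        rw [sub_le_iff_le_add]
        exact_mod_cast (by omega : P ≤ P - 1 + 1)
      exact (mul_le_mul_of_nonneg_right h3 hg0.le).trans (by exact_mod_cast hmain)
    have h3 : (P : ℝ) - 1 ≤ 6 * (dist x / g) + f := by
      rw [← sub_nonneg] at h2 ⊢
      have : 6 * ((dist x : ℝ) / g) + f - (P - 1) = (6 * dist x + g * f - (P - 1) * g) / g := by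
        field_simp
      rw [this]
      positivity
    refine h3.trans ?_
    gcongr
  have h2 : (roundOf A t : ℝ) ≤ ((P : ℝ) + 1) * (65 * dist x) := by
    unfold roundOf
    exact_mod_cast hRP
  have h3 : ((P : ℝ) + 1) * (65 * dist x) ≤ (6 * (dist x / ((k : ℝ) - f)) + f + 2) * (65 * dist x) :=
    mul_le_mul_of_nonneg_right (by linarith) (by positivity)
  refine h2.trans (h3.trans ?_)
  have h4 : (dist x : ℝ) ^ 2 / ((k : ℝ) - f) = dist x / ((k : ℝ) - f) * dist x := by ring
  have h5 : (0 : ℝ) ≤ (dist x : ℝ) * f := by positivity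
  rw [h4]
  nlinarith

end Ants

theorem mainTheorem5 :
    ∃ C : ℝ, ∀ (k f : ℕ), f < k → ∀ (A : Ants.Adversary k f) (treasure : ℤ × ℤ) (D : ℕ),
      D = Ants.dist treasure →
      ∃ t : ℕ, Ants.TerminatesAt Ants.asyncFT A treasure t ∧
        (k ≤ D →
          (Ants.roundOf A t : ℝ) ≤
              C * ((D : ℝ) + (D : ℝ) ^ 2 / ((k : ℝ) - (f : ℝ)) + (D : ℝ) * (f : ℝ)) ∧
          ((Ants.run Ants.asyncFT A t).emissions : ℝ) ≤ C * (D : ℝ)) := by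
  classical
  -- `390 = 6 * 65`: the factor `6` comes from `2N ≤ 6D`, and `65D` bounds the rounds of a phase.
  refine ⟨390, ?_⟩
  rintro k f hf A x D rfl
  rcases Nat.eq_zero_or_pos (Ants.dist x) with hD | hD
  · have hx : x = (0, 0) := by
      unfold Ants.dist at hD
      ext <;> simp only <;> omega
    -- The first step already starts in the nest, and `k ≤ 0` contradicts `f < k`.
    refine ⟨0, ⟨hx.symm, fun u hu => absurd hu (Nat.not_lt_zero u)⟩, fun h => ?_⟩
    omega
  · have hex := Ants.exists_visitsAt (A := A) hD
    have hmin : ∀ u < Nat.find hex, ¬ Ants.VisitsAt Ants.asyncFT A x u :=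
      fun u hu => Nat.find_min hex hu
    refine ⟨Nat.find hex, ⟨Nat.find_spec hex, hmin⟩, fun hk => ?_⟩
    have hI : ∀ u ≤ Nat.find hex, Ants.Invariant A x u := fun u hu =>
      Ants.invariant A hD u fun v hv => hmin v (hv.trans_le hu)
    refine ⟨Ants.round_bound hf hk hD hI, ?_⟩
    rw [Ants.emissions_eq_card]
    have h1 := (hI _ le_rfl).card_pheromones_le (hI _ le_rfl).len_le
    exact_mod_cast h1.trans (by omega)
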